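/- Let $\mathbb H$ be the quaternions, $\mathbb S=\{I\in\mathbb H:\operatorname{Re} I=0,\ |I|=1\}$, and let $\mathbb C_I=\{x+Iy:x,y\in\mathbb R\}$ for $I\in\mathbb S$. A function $f:\mathbb H\to\mathbb H$ is (left) slice regular if it is real differentiable and, for every $I\in\mathbb S$ and all $x,y\in\mathbb R$, $\tfrac12\big(\tfrac{\partial}{\partial x}+I\tfrac{\partial}{\partial y}\big)f(x+Iy)=0$. For $I\in\mathbb S$ and $F\in L^1(\mathbb R;\mathbb H)$ put $\mathscr F_I(F)(t)=\frac1{\sqrt{2\pi}}\int_{\mathbb R}e^{-Ixt}F(x)\,dx$; for $F\in L^2(\mathbb R;\mathbb H)$ let $\mathscr F_I(F)\in L^2(\mathbb R;\mathbb H)$ be the Plancherel extension, i.e. the $L^2$-limit of $\mathscr F_I(\chi_{[-R,R]}F)$ as $R\to\infty$. For $A>0$ let $PW^2_A(\mathbb H)$ be the set of all slice regular $f:\mathbb H\to\mathbb H$ such that $f|_{\mathbb R}\in L^2(\mathbb R)$ and $\operatorname{supp}\mathscr F_I(f|_{\mathbb R})\subset[-A,A]$ for every $I\in\mathbb S$.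 Finally let $\mathrm{sinc}(q)=\sum_{k=0}^\infty q^{2k}\frac{(-\pi^2)^k}{(2k+1)!}$ for $q\in\mathbb H$. Theorem (Reproducing kernel formula). Let $A>0$ and $f\in PW^2_A(\mathbb H)$. Then, for every $q\in\mathbb H$, the function $t\mapsto \mathrm{sinc}\big(\tfrac A\pi(q-t)\big)f(t)$ is integrable on $\mathbb R$ and $$f(q)=\frac A\pi\int_{-\infty}^{\infty}\mathrm{sinc}\Big(\frac A\pi(q-t)\Big)f(t)\,dt .$$ -/

import Mathlib

open MeasureTheory Filter Topology Set
open scoped Quaternion Nat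

noncomputable section

namespace SliceRegular

/-- The sphere `𝕊` of purely imaginary quaternions of norm one. -/
def imagUnits : Set ℍ[ℝ] := {I | I.re = 0 ∧ ‖I‖ = 1}

/-- The point `x + I y` of the complex plane `ℂ_I`. -/
def slicePoint (I : ℍ[ℝ]) (x y : ℝ) : ℍ[ℝ] := (x : ℍ[ℝ]) + I * (y : ℍ[ℝ])

/-- The slice Cauchy-Riemann operator `(1/2) (∂/∂x + I ∂/∂y)`, applied to the restriction of `f`
to the complex plane `ℂ_I`, at the point `x + I y`. -/
def dbar (I : ℍ[ℝ]) (f : ℍ[ℝ] → ℍ[ℝ]) (x y : ℝ) : ℍ[ℝ] :=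
  (1 / 2 : ℝ) • (deriv (fun s : ℝ => f (slicePoint I s y)) x
    + I * deriv (fun s : ℝ => f (slicePoint I x s)) y)

/-- Left slice regular functions on an open set `Ω` of quaternions: real differentiable functions
that are annihilated by the Cauchy-Riemann operator of each slice. -/
def IsLeftSliceRegularOn (f : ℍ[ℝ] → ℍ[ℝ]) (Ω : Set ℍ[ℝ]) : Prop :=
  DifferentiableOn ℝ f Ω ∧
    ∀ I ∈ imagUnits, ∀ x y : ℝ, slicePoint I x y ∈ Ω → dbar I f x y = 0

/-- The one-dimensional left-sided quaternion Fourier transform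
`(1/√(2π)) ∫ e^{-I x t} F(x) dx` of an integrable function `F`. -/
def qFourier (I : ℍ[ℝ]) (F : ℝ → ℍ[ℝ]) (t : ℝ) : ℍ[ℝ] :=
  (1 / Real.sqrt (2 * Real.pi)) • ∫ x : ℝ, NormedSpace.exp (-(I * ((x * t : ℝ) : ℍ[ℝ]))) * F x

/-- `G` is (a representative of) the Fourier-Plancherel transform of the square integrable
function `F`: it is the limit in `L²(ℝ)`, as `R → ∞`, of the transforms of the integrable
functions `χ_{[-R,R]} F`. -/
def IsL2Fourier (I : ℍ[ℝ]) (F G : ℝ → ℍ[ℝ]) : Prop :=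
  MemLp F 2 volume ∧ MemLp G 2 volume ∧
    Tendsto (fun R : ℝ =>
      eLpNorm (fun t => qFourier I (indicator (Icc (-R) R) F) t - G t) 2 volume) atTop (𝓝 0)

/-- The slice regular Paley-Wiener space `PW²_A(ℍ)`: left slice regular functions on the whole
quaternion space whose restriction to the real line is square integrable and has, for each
imaginary unit `I`, a Fourier transform (an element of `L²(ℝ)`) supported in `[-A, A]`. -/
def paleyWiener (A : ℝ) : Set (ℍ[ℝ] → ℍ[ℝ]) :=
  {f | IsLeftSliceRegularOn f univ ∧
    MemLp (fun t : ℝ => f (t : ℍ[ℝ])) 2 volume ∧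
    ∀ I ∈ imagUnits, ∃ G : ℝ → ℍ[ℝ], IsL2Fourier I (fun t : ℝ => f (t : ℍ[ℝ])) G ∧
      ∀ᵐ t : ℝ, t ∉ Icc (-A) A → G t = 0}

/-- The quaternionic sinc function `∑ q^{2k} (-π²)^k / (2k+1)!`. -/
def sinc (q : ℍ[ℝ]) : ℍ[ℝ] :=
  ∑' k : ℕ, q ^ (2 * k) * (((-(Real.pi ^ 2)) ^ k / ((2 * k + 1)! : ℝ) : ℝ) : ℍ[ℝ])

/-- The series that defines `sinc` converges absolutely at every quaternion. -/
theorem summable_norm_sinc (q : ℍ[ℝ]) :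
    Summable fun k : ℕ =>
      ‖q ^ (2 * k) * (((-(Real.pi ^ 2)) ^ k / ((2 * k + 1)! : ℝ) : ℝ) : ℍ[ℝ])‖ := by
  refine Summable.of_nonneg_of_le (fun _ => norm_nonneg _) (fun k => ?_)
    (Real.summable_pow_div_factorial (‖q‖ ^ 2 * Real.pi ^ 2))
  rw [norm_mul, norm_pow, Quaternion.norm_coe, norm_div, norm_pow, norm_neg, norm_pow,
    Real.norm_of_nonneg Real.pi_pos.le, Real.norm_of_nonneg (by positivity), pow_mul, mul_pow,
    mul_div_assoc]
  gcongr
  omega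

end SliceRegular

end

/-! Fix a slice ℂ_I through q. The maps `sliceCoord I c` are linear over ℂ_I acting on the left and
jointly separate points. They turn slice regularity into holomorphy and `qFourier` into
`unitaryFourier`; the kernel takes values in ℂ_I, so it comes out as a complex factor. This leaves a
scalar statement, `eq_integral_complexSinc`.

For f entire on ℂ, the transform G of f|ℝ is in L² and vanishes off [-A, A], hence is integrable.
Inversion writes f(x) as (2π)^(-1/2) ∫ e^{ixs} G(s) ds over [-A, A] for real x, and the identity
theorem extends this to complex z. So f(z) pairs G with a cut-off exponential. Moving the transform
across the pairing (`integral_mul_eq_of_tendsto_unitaryFourier`) pairs f|ℝ with the transform of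
that exponential, a multiple of sinc. The L² transform enters only through such pairings; inversion
itself comes from testing against smooth functions of compact support. -/

namespace SliceRegular

/-! ### Scalar Fourier transform: symmetry and inversion -/

/-- The unitary Fourier transform `(1/√(2π)) ∫ e^{-ixt} F(x) dx` of a complex valued function. -/
noncomputable def unitaryFourier (F : ℝ → ℂ) (t : ℝ) : ℂ :=
  ((1 / Real.sqrt (2 * Real.pi) : ℝ) : ℂ) * ∫ x : ℝ, Complex.exp (-(Complex.I * ((x * t : ℝ) : ℂ))) * F x

theorem norm_exp_neg_I_mul_ofReal (x : ℝ) : ‖Complex.exp (-(Complex.I * (x : ℂ)))‖ = 1 := by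
  rw [Complex.norm_exp]; simp

theorem continuous_unitaryFourier {F : ℝ → ℂ} (hF : Integrable F) :
    Continuous (unitaryFourier F) := by
  refine continuous_const.mul (continuous_of_dominated (bound := fun x => ‖F x‖) ?_ ?_ hF.norm ?_)
  · exact fun t => (Continuous.aestronglyMeasurable (by fun_prop)).mul hF.1
  · exact fun t => .of_forall fun x => by rw [norm_mul, norm_exp_neg_I_mul_ofReal, one_mul]
  · exact .of_forall fun x => by fun_prop

/-- The Fourier transform is symmetric for the bilinear pairing of integrable functions. -/
theorem integral_unitaryFourier_mul {F w : ℝ → ℂ} (hF : Integrable F) (hw : Integrable w) :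
    ∫ t, unitaryFourier F t * w t = ∫ x, F x * unitaryFourier w x := by
  have hint : Integrable (Function.uncurry fun t x : ℝ =>
      Complex.exp (-(Complex.I * ((x * t : ℝ) : ℂ))) * (w t * F x)) (volume.prod volume) := by
    refine (hw.mul_prod hF).norm.mono' ?_ (.of_forall fun p => ?_)
    · exact (Continuous.aestronglyMeasurable (by fun_prop)).mul
        (hw.mul_prod hF).1
    · rw [Function.uncurry_apply_pair, norm_mul, norm_exp_neg_I_mul_ofReal, one_mul]
  have h1 : ∀ t, unitaryFourier F t * w t = ((1 / Real.sqrt (2 * Real.pi) : ℝ) : ℂ) *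
      ∫ x : ℝ, Complex.exp (-(Complex.I * ((x * t : ℝ) : ℂ))) * (w t * F x) := by
    intro t
    rw [unitaryFourier, mul_assoc, ← integral_mul_const]
    simp only [mul_assoc, mul_comm (w t)]
  have h2 : ∀ x, F x * unitaryFourier w x = ((1 / Real.sqrt (2 * Real.pi) : ℝ) : ℂ) *
      ∫ t : ℝ, Complex.exp (-(Complex.I * ((x * t : ℝ) : ℂ))) * (w t * F x) := by
    intro x
    rw [unitaryFourier, mul_comm, mul_assoc, ← integral_mul_const]
    simp only [mul_assoc, mul_comm x]
  simp only [h1, h2, integral_const_mul]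
  rw [integral_integral_swap hint]

/-- The pairing of an `L²` function with functions tending to `0` in `L²` tends to `0`. -/
theorem tendsto_integral_mul_of_eLpNorm_tendsto_zero {H : ℝ → ℝ → ℂ} {w : ℝ → ℂ}
    (hH : ∀ R, AEStronglyMeasurable (H R) volume) (hw : MemLp w 2 volume)
    (h : Tendsto (fun R => eLpNorm (H R) 2 volume) atTop (𝓝 0)) :
    Tendsto (fun R => ∫ t, H R t * w t) atTop (𝓝 0) := by
  rw [tendsto_zero_iff_norm_tendsto_zero]
  have h3 : Tendsto (fun R => (eLpNorm (H R) 2 volume * eLpNorm w 2 volume).toReal) atTop (𝓝 0) := by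
    have := ENNReal.Tendsto.mul_const h (b := eLpNorm w 2 volume) (.inr hw.2.ne)
    rw [zero_mul] at this
    exact (ENNReal.tendsto_toReal ENNReal.zero_ne_top).comp this
  refine tendsto_of_tendsto_of_tendsto_of_le_of_le' tendsto_const_nhds h3
    (.of_forall fun R => norm_nonneg _) ?_
  filter_upwards [h.eventually_lt_const ENNReal.zero_lt_top] with R hR
  have key : eLpNorm (fun t => H R t * w t) 1 volume ≤
      eLpNorm (H R) 2 volume * eLpNorm w 2 volume := by
    have := eLpNorm_smul_le_mul_eLpNorm (p := 2) (q := 2) (r := 1) hw.1 (hH R)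
    rwa [show H R • w = fun t => H R t * w t from rfl] at this
  refine le_trans ?_ (ENNReal.toReal_mono (ENNReal.mul_ne_top hR.ne hw.2.ne) key)
  rw [eLpNorm_one_eq_lintegral_enorm]
  refine (norm_integral_le_lintegral_norm _).trans (le_of_eq ?_)
  simp only [ofReal_norm]

/-- Symmetry of the Fourier-Plancherel transform for the bilinear pairing. -/
theorem integral_mul_eq_of_tendsto_unitaryFourier {F G w : ℝ → ℂ} (hF : MemLp F 2 volume)
    (hG : MemLp G 2 volume)
    (h : Tendsto (fun R : ℝ => eLpNorm
      (fun t => unitaryFourier (indicator (Icc (-R) R) F) t - G t) 2 volume) atTop (𝓝 0))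
    (hw1 : Integrable w) (hw2 : MemLp w 2 volume) (hw : MemLp (unitaryFourier w) 2 volume) :
    ∫ t, G t * w t = ∫ x, F x * unitaryFourier w x := by
  have hFR : ∀ R : ℝ, Integrable (indicator (Icc (-R) R) F) := fun R =>
    (integrable_indicator_iff measurableSet_Icc).2 <|
      (hF.locallyIntegrable (by norm_num)).integrableOn_isCompact isCompact_Icc
  have hFw : Integrable fun x => F x * unitaryFourier w x := hF.integrable_mul hw
  have hGw : Integrable fun x => G x * w x := hG.integrable_mul hw2
  have h1 := tendsto_integral_mul_of_eLpNorm_tendsto_zero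
    (fun R => (continuous_unitaryFourier (hFR R)).aestronglyMeasurable.sub hG.1) hw2 h
  have h2 : Tendsto (fun R : ℝ => ∫ x, indicator (Icc (-R) R) F x * unitaryFourier w x) atTop
      (𝓝 (∫ x, F x * unitaryFourier w x)) := by
    refine tendsto_integral_filter_of_dominated_convergence
      (fun x => ‖F x * unitaryFourier w x‖) (.of_forall fun R => ?_) (.of_forall fun R => ?_)
      hFw.norm (.of_forall fun x => ?_)
    · exact (hFR R).1.mul hw.1
    · refine .of_forall fun x => ?_
      rw [norm_mul, norm_mul]
      gcongr
      exact norm_indicator_le_norm_self _ _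
    · refine tendsto_const_nhds.congr' ?_
      filter_upwards [eventually_ge_atTop |x|] with R hR
      rw [indicator_of_mem]
      exact abs_le.1 hR
  -- The error pairing tends to 0 by `h1` and, by symmetry for each truncation, to the difference of
  -- the two sides.
  refine (sub_eq_zero.1 (tendsto_nhds_unique ((h2.sub_const (∫ t, G t * w t)).congr fun R => ?_)
    h1)).symm
  have hb : Integrable fun t => unitaryFourier (indicator (Icc (-R) R) F) t * w t := by
    refine hw1.bdd_mul (c := ‖((1 / Real.sqrt (2 * Real.pi) : ℝ) : ℂ)‖ *
      ∫ x, ‖indicator (Icc (-R) R) F x‖) (continuous_unitaryFourier (hFR R)).aestronglyMeasurable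
      (.of_forall fun t => ?_)
    rw [unitaryFourier, norm_mul]
    gcongr
    refine (norm_integral_le_integral_norm _).trans (le_of_eq ?_)
    simp only [norm_mul, norm_exp_neg_I_mul_ofReal, one_mul]
  rw [← integral_unitaryFourier_mul (hFR R) hw1, ← integral_sub hb hGw]
  exact integral_congr_ae (.of_forall fun t => (sub_mul _ _ _).symm)

open scoped FourierTransform in
/-- Every Schwartz function is the Fourier transform of its inverse transform. -/
theorem exists_unitaryFourier_eq (ψ : SchwartzMap ℝ ℂ) :
    ∃ w : ℝ → ℂ, Integrable w ∧ MemLp w 2 volume ∧ unitaryFourier w = ψ ∧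
      ∀ s, w s = unitaryFourier ψ (-s) := by
  set g : SchwartzMap ℝ ℂ := 𝓕⁻ ψ with hg
  have hpi := Real.pi_pos
  have hne : (2 * Real.pi)⁻¹ ≠ 0 := by positivity
  set c : ℂ := ((1 / Real.sqrt (2 * Real.pi) : ℝ) : ℂ) with hc
  have hcc : c * c = ((2 * Real.pi)⁻¹ : ℝ) := by
    rw [hc, ← Complex.ofReal_mul, div_mul_div_comm, one_mul, Real.mul_self_sqrt (by positivity),
      one_div]
  -- Rescaling by 1/(2π) passes from the kernel e^{-2πixt} to e^{-ixt}; the Jacobian 2π is absorbed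
  -- by c² = 1/(2π).
  refine ⟨fun s => c * g ((2 * Real.pi)⁻¹ * s), ?_, ?_, ?_, ?_⟩
  · exact (g.integrable.comp_mul_left' hne).const_mul c
  · refine MemLp.const_mul ?_ c
    refine (memLp_two_iff_integrable_sq_norm
      (g.continuous.comp (continuous_const_mul _)).aestronglyMeasurable).2 ?_
    exact ((memLp_two_iff_integrable_sq_norm g.continuous.aestronglyMeasurable).1
      (g.memLp 2)).comp_mul_left' hne
  · ext t
    have h1 : ψ t = (𝓕 g) t := by rw [hg, FourierTransform.fourier_fourierInv_eq]
    rw [h1, SchwartzMap.fourier_coe, Real.fourier_real_eq_integral_exp_smul, unitaryFourier, ← hc]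
    have h2 : ∀ x : ℝ, Complex.exp (-(Complex.I * ((x * t : ℝ) : ℂ))) *
        (c * g ((2 * Real.pi)⁻¹ * x)) = c * (fun v : ℝ => Complex.exp (↑(-2 * Real.pi * v * t) * Complex.I) • g v)
        ((2 * Real.pi)⁻¹ * x) := by
      intro x
      have : ((-2 * Real.pi * ((2 * Real.pi)⁻¹ * x) * t : ℝ) : ℂ) * Complex.I
          = -(Complex.I * ((x * t : ℝ) : ℂ)) := by
        rw [show -2 * Real.pi * ((2 * Real.pi)⁻¹ * x) * t = - (x * t) by field_simp]
        push_cast; ring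
      simp only [this, smul_eq_mul]
      ring
    rw [integral_congr_ae (.of_forall h2), integral_const_mul, Measure.integral_comp_mul_left
      (fun v : ℝ => Complex.exp (↑(-2 * Real.pi * v * t) * Complex.I) • g v), ← mul_assoc, hcc, inv_inv,
      abs_of_pos (by positivity), Complex.real_smul, ← mul_assoc, ← Complex.ofReal_mul,
      inv_mul_cancel₀ (by positivity), Complex.ofReal_one, one_mul]
  · intro s
    beta_reduce
    rw [hg, SchwartzMap.fourierInv_coe, Real.fourierInv_eq', unitaryFourier]
    congr 1
    refine integral_congr_ae (.of_forall fun x => ?_)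
    simp only [smul_eq_mul]
    congr 2
    simp
    field_simp

/-- Fourier inversion for a continuous square integrable function whose Fourier-Plancherel
transform is integrable. -/
theorem eq_unitaryFourier_neg_of_tendsto {F G : ℝ → ℂ} (hFc : Continuous F) (hF : MemLp F 2 volume)
    (hG : MemLp G 2 volume) (hG1 : Integrable G)
    (h : Tendsto (fun R : ℝ => eLpNorm
      (fun t => unitaryFourier (indicator (Icc (-R) R) F) t - G t) 2 volume) atTop (𝓝 0)) (x : ℝ) :
    F x = unitaryFourier G (-x) := by
  have hHc : Continuous fun x => unitaryFourier G (-x) :=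
    (continuous_unitaryFourier hG1).comp continuous_neg
  have hae : F =ᵐ[volume] fun x => unitaryFourier G (-x) := by
    refine ae_eq_of_integral_contDiff_smul_eq hFc.locallyIntegrable
      hHc.locallyIntegrable fun g hg hgs => ?_
    set ψ : SchwartzMap ℝ ℂ := HasCompactSupport.toSchwartzMap (f := fun x => (g x : ℂ))
      (hgs.comp_left (g := fun x : ℝ => (x : ℂ)) rfl) (Complex.ofRealCLM.contDiff.comp hg) with hψ
    obtain ⟨w, h1, h2, h3, h4⟩ := exists_unitaryFourier_eq ψ
    have h5 := integral_mul_eq_of_tendsto_unitaryFourier hF hG h h1 h2 (h3 ▸ ψ.memLp 2)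
    rw [h3] at h5
    have h6 : ∀ x, ψ x = (g x : ℂ) := fun x => rfl
    simp only [h6] at h5
    simp only [Complex.real_smul, mul_comm ((g _ : ℝ) : ℂ)]
    rw [← h5]
    simp only [h4]
    -- Symmetry again, for the reflected test function: reflection commutes with the transform,
    -- which produces the argument -x.
    have h7 := integral_unitaryFourier_mul (F := fun x => ψ (-x)) ψ.integrable.comp_neg hG1
    rw [← integral_neg_eq_self (fun x => ψ (-x) * _)] at h7
    simp only [neg_neg, h6] at h7
    simp only [mul_comm (unitaryFourier G _), mul_comm (G _)]
    rw [← h7]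
    refine integral_congr_ae (.of_forall fun t => ?_)
    simp only [unitaryFourier]
    congr 2
    rw [← integral_neg_eq_self]
    simp [h6]
  exact congrFun ((Continuous.ae_eq_iff_eq _ hFc hHc).1 hae) x

end SliceRegular

/-! ### The sinc kernel and the formula on ℂ -/

namespace SliceRegular

/-- The function `sinc` on the complex plane. -/
noncomputable def complexSinc (w : ℂ) : ℂ :=
  ∑' k : ℕ, w ^ (2 * k) * (((-(Real.pi ^ 2)) ^ k / ((2 * k + 1)! : ℝ) : ℝ) : ℂ)

theorem summable_complexSinc (w : ℂ) :
    Summable fun k : ℕ => w ^ (2 * k) * (((-(Real.pi ^ 2)) ^ k / ((2 * k + 1)! : ℝ) : ℝ) : ℂ) := by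
  refine Summable.of_norm ?_
  refine Summable.of_nonneg_of_le (fun _ => norm_nonneg _) (fun k => ?_)
    (Real.summable_pow_div_factorial (‖w‖ ^ 2 * Real.pi ^ 2))
  rw [norm_mul, norm_pow, Complex.norm_real, norm_div, norm_pow, norm_neg, norm_pow,
    Real.norm_of_nonneg Real.pi_pos.le, Real.norm_of_nonneg (by positivity), pow_mul, mul_pow,
    mul_div_assoc]
  gcongr
  omega

/-- The factor πw turns the even series into the sine series term by term. -/
theorem pi_mul_complexSinc (w : ℂ) :
    (Real.pi : ℂ) * w * complexSinc w = Complex.sin (Real.pi * w) := by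
  have h := (summable_complexSinc w).hasSum.mul_left ((Real.pi : ℂ) * w)
  refine h.unique (Eq.subst (motive := fun u : ℕ → ℂ => HasSum u _) (funext fun k => ?_)
    (Complex.hasSum_sin (Real.pi * w)))
  push_cast
  rw [neg_pow ((Real.pi : ℂ) ^ 2), ← pow_mul, mul_pow _ w, pow_succ, pow_succ]
  ring

theorem complexSinc_zero : complexSinc 0 = 1 := by
  rw [complexSinc, tsum_eq_single 0]
  · simp
  · intro k hk
    simp [hk]

theorem integral_exp_I_mul (A : ℝ) (u : ℂ) :
    ∫ s in (-A)..A, Complex.exp (Complex.I * u * s) =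
      2 * A * complexSinc (((A / Real.pi : ℝ) : ℂ) * u) := by
  have hpi : (Real.pi : ℂ) ≠ 0 := by exact_mod_cast Real.pi_ne_zero
  rcases eq_or_ne u 0 with rfl | hu
  · simp [complexSinc_zero]; ring
  · have h := pi_mul_complexSinc (((A / Real.pi : ℝ) : ℂ) * u)
    rw [integral_exp_mul_complex (mul_ne_zero Complex.I_ne_zero hu)]
    have h1 : (Real.pi : ℂ) * (((A / Real.pi : ℝ) : ℂ) * u) = A * u := by
      push_cast; field_simp
    rw [h1] at h
    rw [div_eq_iff (mul_ne_zero Complex.I_ne_zero hu)]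
    have h2 : 2 * (A : ℂ) * complexSinc (((A / Real.pi : ℝ) : ℂ) * u) * (Complex.I * u) =
        2 * Complex.I * (A * u * complexSinc (((A / Real.pi : ℝ) : ℂ) * u)) := by ring
    rw [h2, h, Complex.sin]
    push_cast
    rw [show Complex.I * u * A = A * u * Complex.I by ring,
      show Complex.I * u * -A = -(A * u) * Complex.I by ring]
    linear_combination (Complex.exp (A * u * Complex.I) - Complex.exp (-(A * u) * Complex.I)) *
      Complex.I_mul_I

theorem norm_exp_I_mul_le {A s : ℝ} (z : ℂ) (hs : s ∈ Icc (-A) A) :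
    ‖Complex.exp (Complex.I * z * s)‖ ≤ Real.exp (A * ‖z‖) := by
  rw [Complex.norm_exp]
  refine Real.exp_le_exp.2 ((Complex.re_le_norm _).trans ?_)
  rw [norm_mul, norm_mul, Complex.norm_I, one_mul, Complex.norm_real, mul_comm]
  gcongr
  exact abs_le.2 hs

/-- The exponential `s ↦ e^{izs}` cut off at `[-A, A]`. -/
noncomputable def truncatedExp (A : ℝ) (z : ℂ) : ℝ → ℂ :=
  indicator (Icc (-A) A) fun s : ℝ => Complex.exp (Complex.I * z * s)

theorem memLp_truncatedExp (A : ℝ) (z : ℂ) (p : ENNReal) : MemLp (truncatedExp A z) p volume := by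
  rw [truncatedExp, memLp_indicator_iff_restrict measurableSet_Icc]
  exact MemLp.of_bound (Continuous.aestronglyMeasurable (by fun_prop)) (Real.exp (A * ‖z‖))
    (ae_restrict_of_forall_mem measurableSet_Icc fun s hs => norm_exp_I_mul_le z hs)

theorem unitaryFourier_truncatedExp_eq_integral {A : ℝ} (hA : 0 < A) (z : ℂ) (t : ℝ) :
    unitaryFourier (truncatedExp A z) t = ((1 / Real.sqrt (2 * Real.pi) : ℝ) : ℂ) *
      ∫ s in (-A)..A, Complex.exp (Complex.I * (z - t) * s) := by
  rw [unitaryFourier, intervalIntegral.integral_of_le (by linarith), ← integral_Icc_eq_integral_Ioc,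
    ← integral_indicator measurableSet_Icc]
  congr 2 with s
  by_cases hs : s ∈ Icc (-A) A
  · rw [truncatedExp, indicator_of_mem hs, indicator_of_mem hs, ← Complex.exp_add]
    congr 1
    push_cast
    ring
  · rw [truncatedExp, indicator_of_notMem hs, indicator_of_notMem hs, mul_zero]

theorem unitaryFourier_truncatedExp {A : ℝ} (hA : 0 < A) (z : ℂ) (t : ℝ) :
    unitaryFourier (truncatedExp A z) t = ((1 / Real.sqrt (2 * Real.pi) : ℝ) : ℂ) *
      (2 * A * complexSinc (((A / Real.pi : ℝ) : ℂ) * (z - t))) := by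
  rw [unitaryFourier_truncatedExp_eq_integral hA, integral_exp_I_mul]

/-- A continuous function that is `O(1 / (t - x))` is square integrable. -/
theorem memLp_two_of_norm_le {k : ℝ → ℂ} (hk : Continuous k) {C D x : ℝ} (hC : ∀ t, ‖k t‖ ≤ C)
    (hD : ∀ t, ‖k t‖ * |t - x| ≤ D) : MemLp k 2 volume := by
  rw [memLp_two_iff_integrable_sq_norm hk.aestronglyMeasurable]
  -- Adding the squares of both bounds gives ‖k t‖² (1 + (t - x)²) ≤ C² + D².
  refine ((integrable_inv_one_add_sq.comp_sub_right x).const_mul (C ^ 2 + D ^ 2)).mono'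
    (by fun_prop) (.of_forall fun t => ?_)
  rw [Real.norm_of_nonneg (by positivity), ← div_eq_mul_inv, le_div_iff₀ (by positivity), mul_add,
    mul_one, ← sq_abs (t - x), ← mul_pow]
  gcongr
  · exact hC t
  · exact hD t

/-- No Plancherel theorem is needed: integrating the exponential explicitly gives decay like 1/|z -
t|, and |t - Re z| ≤ |z - t|. -/
theorem memLp_unitaryFourier_truncatedExp {A : ℝ} (hA : 0 < A) (z : ℂ) :
    MemLp (unitaryFourier (truncatedExp A z)) 2 volume := by
  set c : ℂ := ((1 / Real.sqrt (2 * Real.pi) : ℝ) : ℂ) with hc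
  have hexp : ∀ t s : ℝ, s ∈ Icc (-A) A →
      ‖Complex.exp (Complex.I * (z - t) * s)‖ ≤ Real.exp (A * ‖z‖) := by
    intro t s hs
    rw [mul_sub, sub_mul, sub_eq_add_neg, Complex.exp_add, norm_mul, mul_assoc, mul_assoc,
      ← Complex.ofReal_mul, norm_exp_neg_I_mul_ofReal, mul_one, ← mul_assoc]
    exact norm_exp_I_mul_le z hs
  refine memLp_two_of_norm_le (x := z.re)
    (C := ‖c‖ * (Real.exp (A * ‖z‖) * |A - -A|)) (D := ‖c‖ * (2 * Real.exp (A * ‖z‖)))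
    (continuous_unitaryFourier (memLp_one_iff_integrable.1 (memLp_truncatedExp A z 1)))
    (fun t => ?_) (fun t => ?_)
  · rw [unitaryFourier_truncatedExp_eq_integral hA, norm_mul]
    gcongr
    refine intervalIntegral.norm_integral_le_of_norm_le_const fun s hs => hexp t s ?_
    rw [uIoc_of_le (by linarith)] at hs
    exact Ioc_subset_Icc_self hs
  · rw [unitaryFourier_truncatedExp_eq_integral hA, norm_mul, mul_assoc]
    refine mul_le_mul_of_nonneg_left ?_ (norm_nonneg _)
    have hre : |t - z.re| ≤ ‖z - t‖ := by
      have := Complex.abs_re_le_norm (z - t)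
      rwa [Complex.sub_re, Complex.ofReal_re, abs_sub_comm] at this
    rcases eq_or_ne (z - t) 0 with h0 | h0
    · rw [h0, norm_zero] at hre
      rw [le_antisymm hre (abs_nonneg _), mul_zero]
      positivity
    · have hI : Complex.I * (z - t) ≠ 0 := mul_ne_zero Complex.I_ne_zero h0
      rw [integral_exp_mul_complex hI, norm_div, norm_mul Complex.I, Complex.norm_I, one_mul]
      refine (mul_le_mul_of_nonneg_left hre (by positivity)).trans ?_
      rw [div_mul_cancel₀ _ (norm_ne_zero_iff.2 h0), two_mul]
      exact (norm_sub_le _ _).trans (add_le_add (hexp t A ⟨by linarith, le_rfl⟩)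
        (hexp t (-A) ⟨le_rfl, by linarith⟩))

/-- The Fourier-Laplace transform of an integrable function on `[-A, A]` is entire. -/
theorem differentiable_integral_exp_mul {A : ℝ} {G : ℝ → ℂ} (hG : Integrable G) :
    Differentiable ℂ fun z : ℂ => ∫ s in Icc (-A) A, Complex.exp (Complex.I * z * s) * G s := by
  intro z₀
  have hmeas : ∀ z : ℂ, AEStronglyMeasurable (fun s : ℝ => Complex.exp (Complex.I * z * s) * G s)
      (volume.restrict (Icc (-A) A)) := fun z =>
    (Continuous.aestronglyMeasurable (by fun_prop)).mul hG.1.restrict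
  -- Differentiation under the integral on the unit ball about z₀, where ‖z‖ ≤ ‖z₀‖ + 1 makes the
  -- bound uniform.
  refine (hasDerivAt_integral_of_dominated_loc_of_deriv_le (μ := volume.restrict (Icc (-A) A))
    (F := fun (z : ℂ) (s : ℝ) => Complex.exp (Complex.I * z * s) * G s)
    (F' := fun (z : ℂ) (s : ℝ) => Complex.exp (Complex.I * z * s) * (Complex.I * s) * G s)
    (bound := fun s => Real.exp (A * (‖z₀‖ + 1)) * A * ‖G s‖)
    (Metric.ball_mem_nhds z₀ one_pos) (.of_forall hmeas) ?_ ?_ ?_ ?_ ?_).2.differentiableAt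
  · refine (hG.norm.restrict.const_mul (Real.exp (A * ‖z₀‖))).mono' (hmeas z₀)
      (ae_restrict_of_forall_mem measurableSet_Icc fun s hs => ?_)
    rw [norm_mul]
    gcongr
    exact norm_exp_I_mul_le z₀ hs
  · exact (Continuous.aestronglyMeasurable (by fun_prop)).mul hG.1.restrict
  · refine ae_restrict_of_forall_mem measurableSet_Icc fun s hs z hz => ?_
    have hA : 0 ≤ A := by linarith [hs.1, hs.2]
    have hz' : ‖z‖ ≤ ‖z₀‖ + 1 := by
      have h1 := norm_add_le z₀ (z - z₀)
      rw [add_sub_cancel] at h1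
      have h2 : ‖z - z₀‖ < 1 := by simpa [dist_eq_norm] using hz
      linarith
    rw [norm_mul, norm_mul, norm_mul, Complex.norm_I, one_mul, Complex.norm_real]
    gcongr
    · exact (norm_exp_I_mul_le z hs).trans (Real.exp_le_exp.2 (by gcongr))
    · exact abs_le.2 hs
  · exact hG.norm.restrict.const_mul _
  · refine .of_forall fun s z _ => HasDerivAt.mul_const ?_ _
    have := (((hasDerivAt_id z).const_mul Complex.I).mul_const (s : ℂ)).cexp
    simpa using this

/-- The reproducing kernel formula for entire functions of one complex variable. -/
theorem eq_integral_complexSinc {A : ℝ} (hA : 0 < A) {f : ℂ → ℂ} (hf : Differentiable ℂ f)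
    {G : ℝ → ℂ} (hF : MemLp (fun t : ℝ => f t) 2 volume) (hG : MemLp G 2 volume)
    (h : Tendsto (fun R : ℝ => eLpNorm (fun t =>
      unitaryFourier (indicator (Icc (-R) R) fun t : ℝ => f t) t - G t) 2 volume) atTop (𝓝 0))
    (hsupp : ∀ᵐ t : ℝ, t ∉ Icc (-A) A → G t = 0) (z : ℂ) :
    f z = ((A / Real.pi : ℝ) : ℂ) *
      ∫ t : ℝ, complexSinc (((A / Real.pi : ℝ) : ℂ) * (z - t)) * f t := by
  set c : ℂ := ((1 / Real.sqrt (2 * Real.pi) : ℝ) : ℂ) with hc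
  have hcc : c * c = ((2 * Real.pi)⁻¹ : ℝ) := by
    have hpi := Real.pi_pos
    rw [hc, ← Complex.ofReal_mul, div_mul_div_comm, one_mul, Real.mul_self_sqrt (by positivity),
      one_div]
  have hG1 : Integrable G := IntegrableOn.integrable_of_ae_notMem_eq_zero
    ((hG.locallyIntegrable (by norm_num)).integrableOn_isCompact isCompact_Icc) hsupp
  have hreal : ∀ x : ℝ, f x = c * ∫ s in Icc (-A) A, Complex.exp (Complex.I * x * s) * G s := by
    intro x
    rw [show f x = unitaryFourier G (-x) from eq_unitaryFourier_neg_of_tendsto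
      (hf.continuous.comp Complex.continuous_ofReal) hF hG hG1 h x,
      setIntegral_eq_integral_of_ae_compl_eq_zero, unitaryFourier]
    · congr 2 with s
      congr 2
      push_cast
      ring
    · filter_upwards [hsupp] with s hs hs'
      rw [hs hs', mul_zero]
  have hentire : f = fun z : ℂ =>
      c * ∫ s in Icc (-A) A, Complex.exp (Complex.I * z * s) * G s := by
    -- Identity theorem: the real points, where equality is known, accumulate at 0.
    refine AnalyticOnNhd.eq_of_frequently_eq (z₀ := 0) (fun z _ => hf.analyticAt z)
      (fun z _ => ((differentiable_integral_exp_mul hG1).const_mul c).analyticAt z) ?_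
    have ht : Tendsto (fun x : ℝ => (x : ℂ)) (𝓝[≠] 0) (𝓝[≠] 0) := by
      refine tendsto_nhdsWithin_iff.2 ⟨?_, ?_⟩
      · exact (Complex.continuous_ofReal.tendsto' 0 0 Complex.ofReal_zero).mono_left
          nhdsWithin_le_nhds
      · filter_upwards [self_mem_nhdsWithin] with x hx
        exact Complex.ofReal_ne_zero.2 hx
    exact ht.frequently (Eventually.frequently (.of_forall hreal))
  have hdual := integral_mul_eq_of_tendsto_unitaryFourier hF hG h
    (memLp_one_iff_integrable.1 (memLp_truncatedExp A z 1)) (memLp_truncatedExp A z 2)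
    (memLp_unitaryFourier_truncatedExp hA z)
  have hleft : ∫ t, G t * truncatedExp A z t =
      ∫ s in Icc (-A) A, Complex.exp (Complex.I * z * s) * G s := by
    rw [← integral_indicator measurableSet_Icc]
    congr 1 with s
    by_cases hs : s ∈ Icc (-A) A
    · rw [truncatedExp, indicator_of_mem hs, indicator_of_mem hs, mul_comm]
    · rw [truncatedExp, indicator_of_notMem hs, indicator_of_notMem hs, mul_zero]
  have hright : ∀ t : ℝ, f t * unitaryFourier (truncatedExp A z) t =
      c * (2 * A) * (complexSinc (((A / Real.pi : ℝ) : ℂ) * (z - t)) * f t) := by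
    intro t
    rw [unitaryFourier_truncatedExp hA]
    ring
  rw [integral_congr_ae (.of_forall hright), integral_const_mul, hleft] at hdual
  rw [show f z = _ from congrFun hentire z, hdual, ← mul_assoc, ← mul_assoc, hcc]
  congr 1
  push_cast
  have hpi : (Real.pi : ℂ) ≠ 0 := by exact_mod_cast Real.pi_ne_zero
  field_simp

/-- The sinc kernel is square integrable along the real line. -/
theorem memLp_complexSinc {A : ℝ} (hA : 0 < A) (z : ℂ) :
    MemLp (fun t : ℝ => complexSinc (((A / Real.pi : ℝ) : ℂ) * (z - t))) 2 volume := by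
  have hpi := Real.pi_pos
  have hc : ((1 / Real.sqrt (2 * Real.pi) : ℝ) : ℂ) * (2 * A) ≠ 0 := by
    rw [← Complex.ofReal_ofNat, ← Complex.ofReal_mul, ← Complex.ofReal_mul, Complex.ofReal_ne_zero]
    positivity
  refine ((memLp_unitaryFourier_truncatedExp hA z).const_mul
    (((1 / Real.sqrt (2 * Real.pi) : ℝ) : ℂ) * (2 * A))⁻¹).ae_eq (.of_forall fun t => ?_)
  beta_reduce
  rw [unitaryFourier_truncatedExp hA, ← mul_assoc _ (2 * (A : ℂ)) (complexSinc _),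
    inv_mul_cancel_left₀ hc]

end SliceRegular

/-! ### Slices of ℍ and their complex coordinates -/

namespace SliceRegular

theorem mul_self_of_mem_imagUnits {I : ℍ[ℝ]} (hI : I ∈ imagUnits) : I * I = -1 := by
  have h1 : star I = -I := Quaternion.star_eq_neg.2 hI.1
  have h2 := Quaternion.self_mul_star I
  rw [Quaternion.normSq_eq_norm_mul_self, hI.2, h1, mul_neg, mul_one, Quaternion.coe_one] at h2
  rw [← h2, neg_neg]

/-- The embedding of the complex plane onto the slice `ℂ_I`. -/
noncomputable def sliceHom {I : ℍ[ℝ]} (hI : I ∈ imagUnits) : ℂ →ₐ[ℝ] ℍ[ℝ] :=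
  Complex.lift ⟨I, mul_self_of_mem_imagUnits hI⟩

theorem sliceHom_apply {I : ℍ[ℝ]} (hI : I ∈ imagUnits) (z : ℂ) :
    sliceHom hI z = slicePoint I z.re z.im := by
  simp [sliceHom, Complex.liftAux_apply, slicePoint, Quaternion.mul_coe_eq_smul,
    Quaternion.algebraMap_def]

theorem sliceHom_I {I : ℍ[ℝ]} (hI : I ∈ imagUnits) : sliceHom hI Complex.I = I := by
  simp [sliceHom]

theorem sliceHom_ofReal {I : ℍ[ℝ]} (hI : I ∈ imagUnits) (x : ℝ) : sliceHom hI x = (x : ℍ[ℝ]) := by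
  simp

theorem continuous_sliceHom {I : ℍ[ℝ]} (hI : I ∈ imagUnits) : Continuous (sliceHom hI) :=
  (sliceHom hI).toLinearMap.continuous_of_finiteDimensional

/-- Conjugation commutes with the embedding, so φ(z) φ(z)* = φ(z z̄) = |z|². -/
theorem norm_sliceHom {I : ℍ[ℝ]} (hI : I ∈ imagUnits) (z : ℂ) : ‖sliceHom hI z‖ = ‖z‖ := by
  have h1 : star I = -I := Quaternion.star_eq_neg.2 hI.1
  have h2 : star (sliceHom hI z) = sliceHom hI (star z) := by
    simp [sliceHom_apply, slicePoint, h1, Quaternion.mul_coe_eq_smul]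
  have h3 := Quaternion.self_mul_star (sliceHom hI z)
  rw [h2, ← map_mul, Complex.star_def, Complex.mul_conj, sliceHom_ofReal, Complex.normSq_eq_norm_sq,
    Quaternion.normSq_eq_norm_mul_self, Quaternion.coe_inj, ← sq] at h3
  exact ((sq_eq_sq₀ (norm_nonneg _) (norm_nonneg _)).1 h3).symm

/-- Every quaternion lies in some slice. -/
theorem exists_sliceHom_eq (q : ℍ[ℝ]) :
    ∃ (I : ℍ[ℝ]) (hI : I ∈ imagUnits) (z : ℂ), sliceHom hI z = q := by
  by_cases h : q.im = 0
  -- A real quaternion lies in every slice; any unit serves, here the standard i.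
  · have hI : ((Complex.I : ℂ) : ℍ[ℝ]) ∈ imagUnits := by
      refine ⟨by simp, ?_⟩
      have := congrArg norm (Quaternion.coeComplex_mul Complex.I Complex.I)
      rw [Complex.I_mul_I, norm_mul, ← Complex.ofReal_one, ← Complex.ofReal_neg,
        Quaternion.coeComplex_coe, Quaternion.norm_coe, norm_neg, norm_one] at this
      nlinarith [norm_nonneg ((Complex.I : ℂ) : ℍ[ℝ])]
    refine ⟨_, hI, (q.re : ℂ), ?_⟩
    rw [sliceHom_ofReal]
    simpa [h] using q.re_add_im
  · have hn : ‖q.im‖ ≠ 0 := norm_ne_zero_iff.2 h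
    have hI : ‖q.im‖⁻¹ • q.im ∈ imagUnits := by
      refine ⟨by simp, ?_⟩
      rw [norm_smul, norm_inv, norm_norm, inv_mul_cancel₀ hn]
    refine ⟨_, hI, ⟨q.re, ‖q.im‖⟩, ?_⟩
    rw [sliceHom_apply, slicePoint, Quaternion.mul_coe_eq_smul, smul_smul, mul_inv_cancel₀ hn,
      one_smul]
    exact q.re_add_im

/-- The `ℂ_I`-linear coordinate `q ↦ Re (q c) - i Re (I q c)` of a quaternion. -/
noncomputable def sliceCoord (I c : ℍ[ℝ]) : ℍ[ℝ] →L[ℝ] ℂ :=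
  LinearMap.toContinuousLinearMap
    { toFun := fun q => ⟨(q * c).re, -(I * q * c).re⟩
      map_add' := fun p q => by
        apply Complex.ext <;> simp only [add_mul, mul_add, Quaternion.re_add, Complex.add_re, Complex.add_im]
        ring
      map_smul' := fun r q => by
        apply Complex.ext <;> simp [mul_assoc]
        ring }

theorem sliceCoord_apply (I c q : ℍ[ℝ]) : sliceCoord I c q = ⟨(q * c).re, -(I * q * c).re⟩ := rfl

theorem sliceCoord_sliceHom_mul {I : ℍ[ℝ]} (hI : I ∈ imagUnits) (c q : ℍ[ℝ]) (z : ℂ) :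
    sliceCoord I c (sliceHom hI z * q) = z * sliceCoord I c q := by
  have hi : sliceCoord I c (I * q) = Complex.I * sliceCoord I c q := by
    rw [sliceCoord_apply, sliceCoord_apply, ← mul_assoc I I, mul_self_of_mem_imagUnits hI]
    apply Complex.ext <;> simp
  rw [sliceHom_apply, slicePoint, Quaternion.mul_coe_eq_smul, add_mul, Quaternion.coe_mul_eq_smul,
    smul_mul_assoc, map_add, map_smul, map_smul, hi]
  simp only [Complex.real_smul]
  conv_rhs => rw [← Complex.re_add_im z]
  ring

/-- With c the conjugate of p - q, the real part of the coordinate of p - q is |p - q|². -/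
theorem eq_of_forall_sliceCoord_eq {I p q : ℍ[ℝ]} (h : ∀ c, sliceCoord I c p = sliceCoord I c q) :
    p = q := by
  rw [← sub_eq_zero, ← Quaternion.normSq_eq_zero]
  have h1 : sliceCoord I (star (p - q)) (p - q) = 0 := by rw [map_sub, h, sub_self]
  have h2 := congrArg Complex.re h1
  rw [sliceCoord_apply, Quaternion.self_mul_star] at h2
  simpa using h2

theorem sinc_sliceHom {I : ℍ[ℝ]} (hI : I ∈ imagUnits) (w : ℂ) :
    sinc (sliceHom hI w) = sliceHom hI (complexSinc w) := by
  have h := (summable_complexSinc w).hasSum.map (sliceHom hI) (continuous_sliceHom hI)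
  rw [sinc, complexSinc, ← h.tsum_eq]
  congr 1 with k : 1
  rw [Function.comp_apply, map_mul, map_pow, sliceHom_ofReal]

theorem exp_sliceHom {I : ℍ[ℝ]} (hI : I ∈ imagUnits) (x : ℝ) :
    NormedSpace.exp (-(I * (x : ℍ[ℝ]))) = sliceHom hI (Complex.exp (-(Complex.I * x))) := by
  rw [Complex.exp_eq_exp_ℂ, NormedSpace.map_exp (sliceHom hI) (continuous_sliceHom hI), map_neg,
    map_mul, sliceHom_I, sliceHom_ofReal]

/-- The exponential lies in ℂ_I and stands to the left of F, so the coordinate map carries it to the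
complex exponential. -/
theorem sliceCoord_qFourier {I : ℍ[ℝ]} (hI : I ∈ imagUnits) (c : ℍ[ℝ]) {F : ℝ → ℍ[ℝ]}
    (hF : Integrable F) (t : ℝ) :
    sliceCoord I c (qFourier I F t) = unitaryFourier (fun x => sliceCoord I c (F x)) t := by
  simp only [qFourier, exp_sliceHom hI]
  rw [map_smul, ← ContinuousLinearMap.integral_comp_comm, unitaryFourier, Complex.real_smul]
  · simp only [sliceCoord_sliceHom_mul]
  · refine hF.norm.mono' (AEStronglyMeasurable.mul (Continuous.aestronglyMeasurable ?_) hF.1)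
      (.of_forall fun x => ?_)
    · exact (continuous_sliceHom hI).comp (by fun_prop)
    · rw [norm_mul, norm_sliceHom, norm_exp_neg_I_mul_ofReal, one_mul]

/-- The coordinates of a slice regular function are holomorphic on each slice. -/
theorem differentiable_sliceCoord_comp {I : ℍ[ℝ]} (hI : I ∈ imagUnits) (c : ℍ[ℝ])
    {f : ℍ[ℝ] → ℍ[ℝ]} (hf : IsLeftSliceRegularOn f univ) :
    Differentiable ℂ fun z => sliceCoord I c (f (sliceHom hI z)) := by
  intro z
  have hφ : HasFDerivAt (sliceHom hI) ((sliceHom hI).toLinearMap.toContinuousLinearMap) z :=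
    ((sliceHom hI).toLinearMap.toContinuousLinearMap).hasFDerivAt
  have hfd : HasFDerivAt f (fderiv ℝ f (sliceHom hI z)) (sliceHom hI z) :=
    ((hf.1 _ (mem_univ _)).differentiableAt univ_mem).hasFDerivAt
  have hcomp := (sliceCoord I c).hasFDerivAt.comp z (hfd.comp z hφ)
  refine differentiableAt_complex_iff_differentiableAt_real.2 ⟨hcomp.differentiableAt, ?_⟩
  set L := fderiv ℝ f (sliceHom hI z) with hL
  have h1 : deriv (fun s : ℝ => f (slicePoint I s z.im)) z.re = L 1 := by
    have : HasDerivAt (fun s : ℝ => slicePoint I s z.im) 1 z.re := by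
      simp only [slicePoint]
      have h0 := ((hasDerivAt_id z.re).smul_const (1 : ℍ[ℝ])).add_const (I * (z.im : ℍ[ℝ]))
      simpa only [id, ← Quaternion.coe_mul_eq_smul, mul_one, Quaternion.coe_one] using h0
    rw [sliceHom_apply] at hfd
    exact (hfd.comp_hasDerivAt z.re this).deriv
  have h2 : deriv (fun s : ℝ => f (slicePoint I z.re s)) z.im = L I := by
    have : HasDerivAt (fun s : ℝ => slicePoint I z.re s) I z.im := by
      simp only [slicePoint, Quaternion.mul_coe_eq_smul]
      simpa using ((hasDerivAt_id z.im).smul_const I).const_add (z.re : ℍ[ℝ])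
    rw [sliceHom_apply] at hfd
    exact (hfd.comp_hasDerivAt z.im this).deriv
  have h3 := hf.2 I hI z.re z.im (mem_univ _)
  rw [dbar, h1, h2, smul_eq_zero_iff_right (by norm_num)] at h3
  -- Multiplying the slice equation by I gives this; the coordinate map sends it to the complex
  -- Cauchy-Riemann equation.
  have h4 : L I = I * L 1 := by
    have := congrArg (I * ·) h3
    simp only [mul_add, ← mul_assoc, mul_self_of_mem_imagUnits hI, mul_zero, neg_mul, one_mul] at this
    rw [← sub_eq_add_neg, sub_eq_zero] at this
    exact this.symm
  have h5 := sliceCoord_sliceHom_mul hI c (L 1) Complex.I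
  rw [sliceHom_I, ← h4] at h5
  have h6 : fderiv ℝ (fun z => sliceCoord I c (f (sliceHom hI z))) z = _ := hcomp.fderiv
  rw [h6]
  simpa [sliceHom_I] using h5

end SliceRegular

/-! ### Reduction of the quaternionic formula to ℂ -/

theorem mainTheorem4 (A : ℝ) (hA : 0 < A) (f : ℍ[ℝ] → ℍ[ℝ]) (hf : f ∈ SliceRegular.paleyWiener A)
    (q : ℍ[ℝ]) :
    Integrable (fun t : ℝ => SliceRegular.sinc ((A / Real.pi) • (q - (t : ℍ[ℝ]))) * f (t : ℍ[ℝ]))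
      volume ∧
    f q = (A / Real.pi) •
      ∫ t : ℝ, SliceRegular.sinc ((A / Real.pi) • (q - (t : ℍ[ℝ]))) * f (t : ℍ[ℝ]) := by
  obtain ⟨I, hI, z, rfl⟩ := SliceRegular.exists_sliceHom_eq q
  obtain ⟨hreg, hmem, hsupp⟩ := hf
  obtain ⟨G, ⟨-, hG, hlim⟩, hGsupp⟩ := hsupp I hI
  have hker : ∀ t : ℝ, SliceRegular.sinc ((A / Real.pi) • (SliceRegular.sliceHom hI z - (t : ℍ[ℝ])))
      = SliceRegular.sliceHom hI
        (SliceRegular.complexSinc (((A / Real.pi : ℝ) : ℂ) * (z - t))) := by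
    intro t
    rw [← SliceRegular.sinc_sliceHom, map_mul, map_sub, SliceRegular.sliceHom_ofReal,
      SliceRegular.sliceHom_ofReal, Quaternion.coe_mul_eq_smul]
  simp only [hker]
  have hk := SliceRegular.memLp_complexSinc hA z
  have hint : Integrable (fun t : ℝ => SliceRegular.sliceHom hI
      (SliceRegular.complexSinc (((A / Real.pi : ℝ) : ℂ) * (z - t))) * f (t : ℍ[ℝ])) volume := by
    -- Cauchy-Schwarz: kernel and f|ℝ are both in L².
    refine (hk.norm.integrable_mul hmem.norm).mono' (AEStronglyMeasurable.mul
      ((SliceRegular.continuous_sliceHom hI).comp_aestronglyMeasurable hk.1) hmem.1)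
      (.of_forall fun t => ?_)
    rw [norm_mul, SliceRegular.norm_sliceHom]
    exact le_rfl
  refine ⟨hint, SliceRegular.eq_of_forall_sliceCoord_eq (I := I) fun c => ?_⟩
  rw [map_smul, ← ContinuousLinearMap.integral_comp_comm _ hint, Complex.real_smul]
  simp only [SliceRegular.sliceCoord_sliceHom_mul]
  have hF := (SliceRegular.sliceCoord I c).comp_memLp' hmem
  have hlim' : Tendsto (fun R : ℝ => eLpNorm (fun t => SliceRegular.unitaryFourier
      (indicator (Icc (-R) R) fun t : ℝ => SliceRegular.sliceCoord I c (f (t : ℍ[ℝ]))) t -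
        SliceRegular.sliceCoord I c (G t)) 2 volume) atTop (𝓝 0) := by
    -- L² convergence passes to coordinates at the cost of the operator norm.
    have h0 := ENNReal.Tendsto.const_mul hlim
      (a := ENNReal.ofReal ‖SliceRegular.sliceCoord I c‖) (.inr ENNReal.ofReal_ne_top)
    rw [mul_zero] at h0
    refine tendsto_of_tendsto_of_tendsto_of_le_of_le tendsto_const_nhds h0 (fun R => zero_le)
      fun R => eLpNorm_le_mul_eLpNorm_of_ae_le_mul (.of_forall fun t => ?_) 2
    have hFR : Integrable (indicator (Icc (-R) R) fun t : ℝ => f (t : ℍ[ℝ])) :=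
      (integrable_indicator_iff measurableSet_Icc).2 <|
        (hmem.locallyIntegrable (by norm_num)).integrableOn_isCompact isCompact_Icc
    have hcomm : (indicator (Icc (-R) R) fun t : ℝ => SliceRegular.sliceCoord I c (f (t : ℍ[ℝ]))) =
        fun t => SliceRegular.sliceCoord I c (indicator (Icc (-R) R) (fun t : ℝ => f (t : ℍ[ℝ])) t) :=
      indicator_comp_of_zero (g := SliceRegular.sliceCoord I c) (map_zero _)
    rw [hcomm, ← SliceRegular.sliceCoord_qFourier hI c hFR, ← map_sub]
    exact (SliceRegular.sliceCoord I c).le_opNorm _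
  have key := SliceRegular.eq_integral_complexSinc hA
    (SliceRegular.differentiable_sliceCoord_comp hI c hreg)
    (G := fun t => SliceRegular.sliceCoord I c (G t))
    (by simpa only [SliceRegular.sliceHom_ofReal, Function.comp_def] using hF)
    ((SliceRegular.sliceCoord I c).comp_memLp' hG)
    (by simpa only [SliceRegular.sliceHom_ofReal] using hlim')
    (by
      filter_upwards [hGsupp] with t ht ht'
      rw [ht ht', map_zero]) z
  simpa only [SliceRegular.sliceHom_ofReal] using key
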